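/- **Setting.** Let $T=[0,10]$, $X=[0,1]$, let $\Theta\subseteq\mathbb{R}^{k}$ be open and convex (for instance $\Theta=\mathbb{R}^k$), let $\Theta_{ad}\subset\Theta$ be compact and $\theta_0\in\Theta_{ad}$. Let $u_0(t,x;\theta)$ be the exact model solution on $T\times X\times\Theta$, sufficiently smooth in $\theta$: for all $(t,x)\in T\times X$ it is differentiable in $\theta\in\Theta$, and $\nabla_\theta u_0$ is bounded on $T\times X\times Q$ for every compact $Q\subset\Theta$. A numerical approximation $v(t,x;h,\theta)$ of $v_0(t,x;\theta)$ with step size $h>0$ *has order $p>0$* if for every compact $Q\subset\Theta$ one has, for all sufficiently small $h$, $v=v_0+h^p w$ on $T\times X\times Q$ with $w$ bounded uniformly in $t,x,\theta$ and small $h$, and if for every $h>0$ the map $\theta\mapsto v(\cdot,\cdot;h,\theta)\in L^1(T\times X)$ is continuous on $\Theta$. Let $u(t,x;h,\theta)$ be a numerical approximation of order $p$ of $u_0$, and assume that there is also a numerical approximation of order $p$ of $\nabla_\theta u_0$. For $M,N\ge1$ let $t_i=10(i-1)/M$, $x_j=(j-1)/N$ and let the data be $y_{i,j}=u_0(t_i,x_j;\theta_0)+\epsilon_{i,j}$,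 $1\le i\le M$, $1\le j\le N$, where the $\epsilon_{i,j}=\epsilon^{M,N}_{i,j}$ are, for each $(M,N)$, i.i.d. $\mathcal N(0,\eta^2)$ with $\eta\ge0$ (data sets of different sizes may depend on each other in any way). Let $$J^{M,N}(h,\theta)=\frac1{MN}\sum_{i=1}^M\sum_{j=1}^N\big(y_{i,j}-u(t_i,x_j;h,\theta)\big)^2$$ and let $\hat\theta=\hat\theta^{M,N}(h)$ denote any minimizer of $J^{M,N}(h,\cdot)$ over $\Theta_{ad}$. Put $$A=\tfrac1{MN}\sum\epsilon_{i,j}^2,\quad B=\tfrac1{MN}\sum[u_0(t_i,x_j;\theta_0)-u_0(t_i,x_j;\theta)]^2,\quad C=\tfrac1{MN}\sum[u_0(t_i,x_j;\theta)-u(t_i,x_j;h,\theta)]^2,$$ $$D=\tfrac2{MN}\sum\epsilon_{i,j}\,(u_0(t_i,x_j;\theta_0)-u_0(t_i,x_j;\theta)),\quad E=\tfrac2{MN}\sum\epsilon_{i,j}\,(u_0(t_i,x_j;\theta)-u(t_i,x_j;h,\theta)),$$ $$F=\tfrac2{MN}\sum(u_0(t_i,x_j;\theta)-u(t_i,x_j;h,\theta))(u_0(t_i,x_j;\theta_0)-u_0(t_i,x_j;\theta)).$$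 **Lemma 1.** One has $J^{M,N}(h,\theta)=A+B+C+D+E+F$ for all $h,\theta$. At $\theta=\hat\theta$ the terms behave, as $h\to0$ and with enough data points, as $A=O(1)$, $B=O(h^p)$, $C=O(h^{2p})$, $D=O(h^{p/2})$, $E=O(h^p)$, $F=O(h^{3p/2})$. Precisely, there are deterministic constants $K,h_0>0$ such that: 1. for every realization and every fixed $M,N\ge1$ there is a constant $L$ (depending on the data set) such that for all $0<h<h_0$ and every minimizer $\hat\theta$: $A\le L$, $C\le Kh^{2p}$, $|E|\le Lh^p$; 2. almost surely, for every $0<h<h_0$ there is $R$ such that for all $M,N\ge1$ with $MN\ge R$ and every minimizer $\hat\theta$: $$A\le K,\quad B\le Kh^p,\quad C\le Kh^{2p},\quad |D|\le Kh^{p/2},\quad |E|\le Kh^p,\quad |F|\le Kh^{3p/2}.$$ -/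

import Mathlib

open MeasureTheory ProbabilityTheory Set

noncomputable section

namespace NumOLS

/-- Parameter vectors, with the Euclidean norm. -/
abbrev Param (k : ℕ) : Type := EuclideanSpace ℝ (Fin k)

/-- The temporal domain. -/
def timeDom : Set ℝ := Icc 0 10

/-- The spatial domain. -/
def spaceDom : Set ℝ := Icc 0 1

/-- The `i`-th of `M` observation times, counted from `0`. -/
def timePt (M : ℕ) (i : Fin M) : ℝ := 10 * ((i : ℕ) : ℝ) / (M : ℝ)

/-- The `j`-th of `N` observation locations, counted from `0`. -/
def spacePt (N : ℕ) (j : Fin N) : ℝ := ((j : ℕ) : ℝ) / (N : ℝ)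

/-- The family `v t x h θ` of numerical approximations (`h` is the step size) of `v₀ t x θ` has
order of convergence `p`: on every compact set `Q` of parameters, for all small `h`,
`v = v₀ + h ^ p • w` on the whole space-time domain with `w` uniformly bounded; moreover, for every
step size, `θ ↦ v (·, ·; h, θ)` is a continuous map from the parameter domain to `L¹`. -/
def HasOrder {k : ℕ} {F : Type*} [NormedAddCommGroup F] [NormedSpace ℝ F] (Θ : Set (Param k))
    (p : ℝ) (v₀ : ℝ → ℝ → Param k → F) (v : ℝ → ℝ → ℝ → Param k → F) : Prop :=
  (∀ Q : Set (Param k), IsCompact Q → Q ⊆ Θ →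
    ∃ w : ℝ → ℝ → ℝ → Param k → F, ∃ W : ℝ, ∃ h₁ : ℝ, 0 < h₁ ∧
      ∀ h ∈ Ioo 0 h₁, ∀ θ ∈ Q, ∀ t ∈ timeDom, ∀ x ∈ spaceDom,
        v t x h θ = v₀ t x θ + h ^ p • w t x h θ ∧ ‖w t x h θ‖ ≤ W) ∧
  (∀ h : ℝ, 0 < h →
    ∃ V : Param k → Lp F 1 ((volume : Measure (ℝ × ℝ)).restrict (timeDom ×ˢ spaceDom)),
      ContinuousOn V Θ ∧
      ∀ θ ∈ Θ, V θ =ᵐ[(volume : Measure (ℝ × ℝ)).restrict (timeDom ×ˢ spaceDom)]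
        fun z => v z.1 z.2 h θ)

/-- The model is sufficiently smooth in the parameter: it is differentiable, with a gradient that
is bounded uniformly in space and time on every compact set of parameters. -/
def SmoothInParam {k : ℕ} (Θ : Set (Param k)) (u₀ : ℝ → ℝ → Param k → ℝ) : Prop :=
  (∀ t ∈ timeDom, ∀ x ∈ spaceDom, ∀ θ ∈ Θ, DifferentiableAt ℝ (u₀ t x) θ) ∧
  (∀ Q : Set (Param k), IsCompact Q → Q ⊆ Θ →
    ∃ L : ℝ, ∀ θ ∈ Q, ∀ t ∈ timeDom, ∀ x ∈ spaceDom, ‖gradient (u₀ t x) θ‖ ≤ L)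

/-- Average over the `M * N` grid points. -/
def avg {M N : ℕ} (f : Fin M → Fin N → ℝ) : ℝ :=
  (1 / ((M : ℝ) * (N : ℝ))) * ∑ i, ∑ j, f i j

section Terms

variable {k M N : ℕ} (u₀ : ℝ → ℝ → Param k → ℝ) (u : ℝ → ℝ → ℝ → Param k → ℝ)
  (θ₀ : Param k) (e : Fin M → Fin N → ℝ) (h : ℝ) (θ : Param k)

/-- The data: exact model at the true parameter plus noise `e`. -/
def data (i : Fin M) (j : Fin N) : ℝ :=
  u₀ (timePt M i) (spacePt N j) θ₀ + e i j

/-- The numerical ordinary least squares cost for a data set `y`. -/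
def cost (y : Fin M → Fin N → ℝ) : ℝ :=
  avg fun i j => (y i j - u (timePt M i) (spacePt N j) h θ) ^ 2

/-- `θ` is an ordinary least squares estimate: it minimizes the numerical cost for the data set `y`
over the admissible set. -/
def IsEstimate (Θad : Set (Param k)) (y : Fin M → Fin N → ℝ) : Prop :=
  θ ∈ Θad ∧ ∀ θ' ∈ Θad, cost u h θ y ≤ cost u h θ' y

/-- Noise. -/
def termA : ℝ := avg fun i j => e i j ^ 2

/-- Model misfit. -/
def termB (M N : ℕ) : ℝ :=
  avg fun (i : Fin M) (j : Fin N) =>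
    (u₀ (timePt M i) (spacePt N j) θ₀ - u₀ (timePt M i) (spacePt N j) θ) ^ 2

/-- Numerical error. -/
def termC (M N : ℕ) : ℝ :=
  avg fun (i : Fin M) (j : Fin N) =>
    (u₀ (timePt M i) (spacePt N j) θ - u (timePt M i) (spacePt N j) h θ) ^ 2

/-- Noise against model misfit. -/
def termD : ℝ :=
  2 * avg fun i j =>
    e i j * (u₀ (timePt M i) (spacePt N j) θ₀ - u₀ (timePt M i) (spacePt N j) θ)

/-- Noise against numerical error. -/
def termE : ℝ :=
  2 * avg fun i j =>
    e i j * (u₀ (timePt M i) (spacePt N j) θ - u (timePt M i) (spacePt N j) h θ)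

/-- Numerical error against model misfit. -/
def termF (M N : ℕ) : ℝ :=
  2 * avg fun (i : Fin M) (j : Fin N) =>
    (u₀ (timePt M i) (spacePt N j) θ - u (timePt M i) (spacePt N j) h θ) *
      (u₀ (timePt M i) (spacePt N j) θ₀ - u₀ (timePt M i) (spacePt N j) θ)

end Terms

end NumOLS

end

namespace NumOLS

/-! Expanding the square gives the six terms. At `θ₀` the terms B, D and F vanish, and A does not
depend on the parameter, so minimality of the estimate bounds B by C and |E| at `θ₀` plus |D|, |E|
and |F| at the estimate (`IsEstimate.termB_le`). The order of the scheme gives C = O(h^(2p)), and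
Cauchy–Schwarz bounds |E| by 2√(A·C) and |F| by 2√(B·C). The argument for B is a bootstrap. The
crude bound B ≤ G², from compactness and the Lipschitz property, makes F = O(h^p); hence B = O(h^p)
as soon as |D| ≤ h^p. Returning this to Cauchy–Schwarz sharpens F to O(h^(3p/2)). Only A and D need
probability. Data sets of different sizes may be dependent, so tails exponentially small in MN are
combined with the first Borel–Cantelli lemma; a finite net makes the bound on D uniform in the
parameter, as the estimate depends on the noise. -/

/-! ### Grid averages and Cauchy–Schwarz. -/

lemma avg_eq_sum_prod {M N : ℕ} (f : Fin M → Fin N → ℝ) :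
    avg f = (1 / ((M : ℝ) * (N : ℝ))) * ∑ q : Fin M × Fin N, f q.1 q.2 := by
  rw [avg, Fintype.sum_prod_type]

lemma avg_add {M N : ℕ} (f g : Fin M → Fin N → ℝ) :
    avg (fun i j => f i j + g i j) = avg f + avg g := by
  simp only [avg_eq_sum_prod, Finset.sum_add_distrib, mul_add]

lemma avg_const_mul {M N : ℕ} (c : ℝ) (f : Fin M → Fin N → ℝ) :
    avg (fun i j => c * f i j) = c * avg f := by
  simp only [avg_eq_sum_prod, ← Finset.mul_sum]
  ring

lemma avg_mono {M N : ℕ} {f g : Fin M → Fin N → ℝ} (h : ∀ i j, f i j ≤ g i j) :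
    avg f ≤ avg g := by
  simp only [avg_eq_sum_prod]
  gcongr with q
  exact h q.1 q.2

lemma avg_nonneg {M N : ℕ} {f : Fin M → Fin N → ℝ} (h : ∀ i j, 0 ≤ f i j) : 0 ≤ avg f := by
  simp only [avg_eq_sum_prod]
  exact mul_nonneg (by positivity) (Finset.sum_nonneg fun q _ => h q.1 q.2)

/-- Only an inequality, because the average over an empty grid is `0`. -/
lemma avg_const_le {M N : ℕ} {c : ℝ} (hc : 0 ≤ c) :
    avg (fun (_ : Fin M) (_ : Fin N) => c) ≤ c := by
  simp only [avg_eq_sum_prod, Finset.sum_const, Finset.card_univ, Fintype.card_prod,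
    Fintype.card_fin, nsmul_eq_mul, Nat.cast_mul]
  rw [← mul_assoc, one_div]
  exact mul_le_of_le_one_left hc (inv_mul_le_one_of_le₀ le_rfl (by positivity))

/-- Cauchy–Schwarz for grid averages. -/
lemma avg_mul_sq_le {M N : ℕ} (f g : Fin M → Fin N → ℝ) :
    avg (fun i j => f i j * g i j) ^ 2 ≤
      avg (fun i j => f i j ^ 2) * avg (fun i j => g i j ^ 2) := by
  simp only [avg_eq_sum_prod]
  have := Finset.sum_mul_sq_le_sq_mul_sq Finset.univ
    (fun q : Fin M × Fin N => f q.1 q.2) (fun q => g q.1 q.2)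
  calc _ = (1 / ((M : ℝ) * (N : ℝ))) ^ 2 * (∑ q : Fin M × Fin N, f q.1 q.2 * g q.1 q.2) ^ 2 := by
        ring
    _ ≤ (1 / ((M : ℝ) * (N : ℝ))) ^ 2 * ((∑ q : Fin M × Fin N, f q.1 q.2 ^ 2) *
          ∑ q : Fin M × Fin N, g q.1 q.2 ^ 2) := by gcongr
    _ = _ := by ring

lemma avg_sq_le {M N : ℕ} {f : Fin M → Fin N → ℝ} {c : ℝ} (h : ∀ i j, |f i j| ≤ c) :
    avg (fun i j => f i j ^ 2) ≤ c ^ 2 :=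
  (avg_mono fun i j => sq_le_sq' (abs_le.1 (h i j)).1 (abs_le.1 (h i j)).2).trans
    (avg_const_le (sq_nonneg c))

/-- Bilinear bound: the average of a product in terms of mean squares. -/
lemma abs_avg_mul_le {M N : ℕ} {f g : Fin M → Fin N → ℝ} {a b : ℝ} (ha : 0 ≤ a) (hb : 0 ≤ b)
    (hf : avg (fun i j => f i j ^ 2) ≤ a ^ 2) (hg : avg (fun i j => g i j ^ 2) ≤ b ^ 2) :
    |avg (fun i j => f i j * g i j)| ≤ a * b := by
  refine abs_le_of_sq_le_sq ?_ (by positivity)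
  calc _ ≤ _ := avg_mul_sq_le f g
    _ ≤ a ^ 2 * b ^ 2 := by
      gcongr
      exact avg_nonneg fun i j => sq_nonneg _
    _ = _ := by ring

lemma timePt_mem {M : ℕ} (i : Fin M) : timePt M i ∈ timeDom := by
  have hM : (0 : ℝ) < M := by exact_mod_cast i.pos
  have hi : ((i : ℕ) : ℝ) ≤ M := by exact_mod_cast i.2.le
  refine ⟨by unfold timePt; positivity, ?_⟩
  rw [timePt, div_le_iff₀ hM]
  linarith

lemma spacePt_mem {N : ℕ} (j : Fin N) : spacePt N j ∈ spaceDom := by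
  have hN : (0 : ℝ) < N := by exact_mod_cast j.pos
  have hj : ((j : ℕ) : ℝ) ≤ N := by exact_mod_cast j.2.le
  refine ⟨by unfold spacePt; positivity, ?_⟩
  rw [spacePt, div_le_iff₀ hN]
  linarith

/-! ### Cost splitting, and uniform bounds on the model and the numerical error. -/

lemma cost_data_eq {k M N : ℕ} (u₀ : ℝ → ℝ → Param k → ℝ) (u : ℝ → ℝ → ℝ → Param k → ℝ)
    (θ₀ : Param k) (e : Fin M → Fin N → ℝ) (h : ℝ) (θ : Param k) :
    cost u h θ (data u₀ θ₀ e) = termA e + termB u₀ θ₀ θ M N + termC u₀ u h θ M N +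
      termD u₀ θ₀ e θ + termE u₀ u e h θ + termF u₀ u θ₀ h θ M N := by
  simp only [cost, termA, termB, termC, termD, termE, termF, ← avg_const_mul, ← avg_add]
  congr 1
  funext i j
  simp only [data]
  ring

/-- A smooth model is Lipschitz in the parameter on a compact set, uniformly in space and time. -/
lemma SmoothInParam.exists_lipschitz {k : ℕ} {Θ K : Set (Param k)} {u₀ : ℝ → ℝ → Param k → ℝ}
    (hu₀ : SmoothInParam Θ u₀) (hΘ : Convex ℝ Θ) (hK : IsCompact K) (hsub : K ⊆ Θ) :
    ∃ L : ℝ, 0 ≤ L ∧ ∀ t ∈ timeDom, ∀ x ∈ spaceDom, ∀ θ ∈ K, ∀ θ' ∈ K,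
      |u₀ t x θ - u₀ t x θ'| ≤ L * ‖θ - θ'‖ := by
  -- `K` need not be convex, so the mean value inequality needs the gradient bound on the union of
  -- all segments between points of `K`. This is a compact set, contained in `Θ` by convexity.
  set Q : Set (Param k) :=
    (fun z : (Param k × Param k) × ℝ => AffineMap.lineMap z.1.1 z.1.2 z.2) '' ((K ×ˢ K) ×ˢ Icc 0 1)
  have hQc : IsCompact Q := ((hK.prod hK).prod isCompact_Icc).image (by
    simp only [AffineMap.lineMap_apply_module']
    fun_prop)
  have hseg : ∀ θ ∈ K, ∀ θ' ∈ K, segment ℝ θ' θ ⊆ Q := fun θ hθ θ' hθ' => by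
    rw [segment_eq_image_lineMap]
    rintro _ ⟨c, hc, rfl⟩
    exact ⟨((θ', θ), c), ⟨⟨hθ', hθ⟩, hc⟩, rfl⟩
  have hQ : Q ⊆ Θ := by
    rintro _ ⟨z, ⟨⟨h1, h2⟩, hc⟩, rfl⟩
    exact hΘ.lineMap_mem (hsub h1) (hsub h2) hc
  obtain ⟨L, hL⟩ := hu₀.2 _ hQc hQ
  refine ⟨max L 0, le_max_right _ _, fun t ht x hx θ hθ θ' hθ' => ?_⟩
  refine (convex_segment θ' θ).norm_image_sub_le_of_norm_hasFDerivWithin_le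
    (f' := fun θ => fderiv ℝ (u₀ t x) θ)
    (fun ζ hζ => (hu₀.1 t ht x hx ζ (hQ (hseg θ hθ θ' hθ' hζ))).hasFDerivAt.hasFDerivWithinAt)
    (fun ζ hζ => ?_) (left_mem_segment ℝ θ' θ) (right_mem_segment ℝ θ' θ)
  have := hL ζ (hseg θ hθ θ' hθ' hζ) t ht x hx
  rw [gradient, LinearIsometryEquiv.norm_map] at this
  exact this.trans (le_max_left _ _)

/-- On a compact set of parameters the numerical error is at most a constant times `h ^ p`. -/
lemma HasOrder.exists_error_le {k : ℕ} {Θ K : Set (Param k)} {p : ℝ} {u₀ : ℝ → ℝ → Param k → ℝ}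
    {u : ℝ → ℝ → ℝ → Param k → ℝ} (hu : HasOrder Θ p u₀ u) (hK : IsCompact K) (hsub : K ⊆ Θ) :
    ∃ W : ℝ, 0 ≤ W ∧ ∃ h₁ > 0, ∀ h ∈ Ioo 0 h₁, ∀ t ∈ timeDom, ∀ x ∈ spaceDom, ∀ θ ∈ K,
      |u₀ t x θ - u t x h θ| ≤ W * h ^ p := by
  obtain ⟨w, W, h₁, h₁pos, H⟩ := hu.1 K hK hsub
  refine ⟨max W 0, le_max_right _ _, h₁, h₁pos, fun h hh t ht x hx θ hθ => ?_⟩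
  obtain ⟨h1, h2⟩ := H h hh θ hθ t ht x hx
  have hpos : 0 ≤ h ^ p := Real.rpow_nonneg hh.1.le p
  rw [h1, sub_add_cancel_left, abs_neg, smul_eq_mul, abs_mul, abs_of_nonneg hpos, mul_comm]
  gcongr
  exact h2.trans (le_max_left _ _)

/-! ### Almost sure bounds for the noise. -/

/-- Borel–Cantelli for events indexed by grids, with probabilities exponentially small in the
number of grid points. -/
lemma ae_exists_forall_notMem_of_measureReal_le_exp {Ω : Type*} [MeasurableSpace Ω]
    (P : Measure Ω) [IsProbabilityMeasure P] (S : ℕ → ℕ → Set Ω) {C c : ℝ} (hc : 0 < c)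
    (hS : ∀ M N, 0 < M → 0 < N → P.real (S M N) ≤ C * Real.exp (-c * ((M : ℝ) * N))) :
    ∀ᵐ ω ∂P, ∃ R : ℕ, ∀ M N : ℕ, 0 < M → 0 < N → R ≤ M * N → ω ∉ S M N := by
  have hr : Real.exp (-c) < 1 := by simpa using hc
  have hgeo := summable_geometric_of_lt_one (Real.exp_pos (-c)).le hr
  have hsum : Summable fun q : ℕ × ℕ => P.real (S (q.1 + 1) (q.2 + 1)) := by
    have hC : 0 ≤ C := by
      have := measureReal_nonneg.trans (hS 1 1 one_pos one_pos)
      exact nonneg_of_mul_nonneg_left this (Real.exp_pos _)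
    refine Summable.of_nonneg_of_le (fun _ => measureReal_nonneg) (fun q => ?_)
      ((hgeo.mul_of_nonneg hgeo (fun _ => by positivity) fun _ => by positivity).mul_left C)
    -- Since (m+1)(n+1) ≥ m+n, a product of two geometric series dominates.
    refine (hS _ _ q.1.succ_pos q.2.succ_pos).trans ?_
    rw [← Real.exp_nat_mul, ← Real.exp_nat_mul, ← Real.exp_add]
    gcongr
    push_cast
    nlinarith [mul_nonneg hc.le (mul_nonneg q.1.cast_nonneg q.2.cast_nonneg :
      (0 : ℝ) ≤ (q.1 : ℝ) * q.2)]
  have hne : ∑' q : ℕ × ℕ, P (S (q.1 + 1) (q.2 + 1)) ≠ ⊤ := by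
    have := hsum.tsum_ofReal_ne_top
    simpa only [measureReal_def, ENNReal.ofReal_toReal (measure_ne_top P _)] using this
  -- Almost surely only finitely many grids are bad, so their sizes MN are bounded.
  filter_upwards [ae_finite_setOfPred_mem hne] with ω hω
  obtain ⟨R, hR⟩ := (hω.image fun q => (q.1 + 1) * (q.2 + 1)).bddAbove
  refine ⟨R + 1, fun M N hM hN hMN hmem => ?_⟩
  have := hR ⟨(M - 1, N - 1), by simpa [Nat.sub_add_cancel hM, Nat.sub_add_cancel hN], rfl⟩
  simp only [Nat.sub_add_cancel hM, Nat.sub_add_cancel hN] at this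
  omega

section Noise

variable {Ω : Type*} [MeasurableSpace Ω] {P : Measure Ω}

/-- The slack in `hc` lets different weights share one variance proxy. -/
lemma hasSubgaussianMGF_const_mul_of_hasLaw_gaussianReal {X : Ω → ℝ} {v : NNReal}
    (hX : HasLaw X (gaussianReal 0 v) P) {a : ℝ} {c : NNReal} (hc : a ^ 2 * v ≤ c) :
    HasSubgaussianMGF (fun ω => a * X ω) c P := by
  refine ⟨fun t => ?_, fun t => ?_⟩
  · have h := integrable_exp_mul_gaussianReal (μ := 0) (v := v) (t * a)
    rw [← hX.map_eq, integrable_map_measure (by fun_prop) hX.aemeasurable] at h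
    simpa only [Function.comp_def, mul_assoc] using h
  · rw [mgf_const_mul, mgf_gaussianReal hX.map_eq]
    gcongr
    nlinarith [mul_le_mul_of_nonneg_right hc (sq_nonneg t)]

variable [IsProbabilityMeasure P]

/-- Two-sided Hoeffding bound for bounded linear combinations of i.i.d. centred Gaussians. -/
lemma measureReal_le_abs_sum_mul_gaussian_le {ι : Type*} [Fintype ι] {X : ι → Ω → ℝ} {v : NNReal}
    (hlaw : ∀ i, HasLaw (X i) (gaussianReal 0 v) P) (hind : iIndepFun X P) {a : ι → ℝ}
    {c : NNReal} (hc : ∀ i, a i ^ 2 * v ≤ c) {δ : ℝ} (hδ : 0 ≤ δ) :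
    P.real {ω | δ * Fintype.card ι ≤ |∑ i, a i * X i ω|} ≤
      2 * Real.exp (-(δ ^ 2 / (2 * c)) * Fintype.card ι) := by
  have one_sided : ∀ b : ι → ℝ, (∀ i, b i ^ 2 * v ≤ c) →
      P.real {ω | δ * Fintype.card ι ≤ ∑ i, b i * X i ω} ≤
        Real.exp (-(δ ^ 2 / (2 * c)) * Fintype.card ι) := by
    intro b hb
    have hind' : iIndepFun (fun i ω => b i * X i ω) P :=
      hind.comp (fun i x => b i * x) fun i => by fun_prop
    refine (HasSubgaussianMGF.measure_sum_ge_le_of_iIndepFun hind' (c := fun _ => c)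
      (s := Finset.univ)
      (fun i _ => hasSubgaussianMGF_const_mul_of_hasLaw_gaussianReal (hlaw i) (hb i))
      (by positivity)).trans_eq ?_
    congr 1
    simp only [Finset.sum_const, Finset.card_univ, nsmul_eq_mul]
    -- In the degenerate cases both exponents are `0`, by the convention x/0 = 0 where needed.
    rcases eq_or_ne (Fintype.card ι : ℝ) 0 with h0 | h0
    · simp [h0]
    rcases eq_or_ne (c : ℝ) 0 with h1 | h1
    · simp [h1]
    push_cast
    field_simp
  refine (measureReal_mono (s₂ := {ω | δ * Fintype.card ι ≤ ∑ i, a i * X i ω} ∪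
    {ω | δ * Fintype.card ι ≤ ∑ i, -a i * X i ω}) fun ω hω => ?_).trans
    ((measureReal_union_le _ _).trans ?_)
  · rcases le_abs.1 (mem_ofPred_eq ▸ hω) with h | h
    · exact Or.inl h
    · refine Or.inr ?_
      simpa only [mem_ofPred_eq, neg_mul, Finset.sum_neg_distrib] using h
  · rw [two_mul]
    exact add_le_add (one_sided a hc) (one_sided _ fun i => by simpa using hc i)

/-- Sums of squares of i.i.d. Gaussians are at most linear, outside an event of exponentially small
probability. -/
lemma exists_measureReal_le_sum_sq_gaussian_le (v : NNReal) :
    ∃ K : ℝ, 0 ≤ K ∧ ∀ {ι : Type} [Fintype ι] {X : ι → Ω → ℝ},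
      (∀ i, HasLaw (X i) (gaussianReal 0 v) P) → iIndepFun X P →
      P.real {ω | K * Fintype.card ι ≤ ∑ i, X i ω ^ 2} ≤ Real.exp (-1 * Fintype.card ι) := by
  -- Fernique's theorem supplies a finite exponential moment of the square, so Chernoff's bound
  -- applies.
  obtain ⟨t, ht, hint⟩ := IsGaussian.exists_integrable_exp_sq (gaussianReal 0 v)
  simp only [Real.norm_eq_abs, sq_abs] at hint
  set m : ℝ := ∫ x, Real.exp (t * x ^ 2) ∂(gaussianReal 0 v) with hm
  have hm0 : 0 < m := integral_exp_pos hint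
  -- With n variables, Chernoff gives exp(-(m+1)n)·m^n, and m ≤ exp m leaves exp(-n).
  refine ⟨(m + 1) / t, by positivity, fun {ι _ X} hlaw hind => ?_⟩
  have hmeas : ∀ i, AEMeasurable (fun ω => X i ω ^ 2) P := fun i =>
    (hlaw i).aemeasurable.pow_const 2
  have hind2 : iIndepFun (fun i ω => X i ω ^ 2) P :=
    hind.comp (fun _ x => x ^ 2) fun _ => by fun_prop
  have hmgf : ∀ i, mgf (fun ω => X i ω ^ 2) P t = m := fun i => by
    rw [hm, ← (hlaw i).map_eq, integral_map (hlaw i).aemeasurable (by fun_prop), mgf]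
  have hmgfS : mgf (∑ i, fun ω => X i ω ^ 2) P t = m ^ Fintype.card ι := by
    rw [hind2.mgf_sum₀ hmeas, Finset.prod_congr rfl fun i _ => hmgf i, Finset.prod_const,
      Finset.card_univ]
  have hintS : Integrable (fun ω => Real.exp (t * (∑ i, fun ω => X i ω ^ 2) ω)) P :=
    -- A non-integrable exponential would give the default value `0` of `mgf`, whereas this one is
    -- positive.
    not_imp_comm.1 mgf_undef (hmgfS.trans_ne (pow_pos hm0 _).ne')
  have key := measure_ge_le_exp_mul_mgf ((m + 1) / t * Fintype.card ι) ht.le hintS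
  rw [hmgfS] at key
  simp only [Finset.sum_apply] at key
  refine key.trans ?_
  have hpow : m ^ Fintype.card ι ≤ Real.exp (m * Fintype.card ι) := by
    rw [mul_comm, Real.exp_nat_mul]
    gcongr
    linarith [Real.add_one_le_exp m]
  calc _ ≤ Real.exp (-t * ((m + 1) / t * Fintype.card ι)) * Real.exp (m * Fintype.card ι) := by
        gcongr
    _ = _ := by
      rw [← Real.exp_add]
      congr 1
      field_simp
      ring

variable {v : NNReal} {ε : (M N : ℕ) → Fin M → Fin N → Ω → ℝ}

/-- The empirical second moment of the noise is almost surely eventually bounded. -/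
lemma exists_ae_termA_le (hlaw : ∀ M N i j, HasLaw (ε M N i j) (gaussianReal 0 v) P)
    (hind : ∀ M N, iIndepFun (fun q : Fin M × Fin N => ε M N q.1 q.2) P) :
    ∃ K : ℝ, 0 ≤ K ∧ ∀ᵐ ω ∂P, ∃ R : ℕ, ∀ M N : ℕ, 0 < M → 0 < N → R ≤ M * N →
      termA (fun i j => ε M N i j ω) ≤ K ^ 2 := by
  obtain ⟨K, hK, hKP⟩ := exists_measureReal_le_sum_sq_gaussian_le (P := P) v
  refine ⟨√K, Real.sqrt_nonneg K, ?_⟩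
  rw [Real.sq_sqrt hK]
  filter_upwards [ae_exists_forall_notMem_of_measureReal_le_exp P
    (fun M N => {ω | K * Fintype.card (Fin M × Fin N) ≤
      ∑ q : Fin M × Fin N, ε M N q.1 q.2 ω ^ 2}) (C := 1) (c := 1) one_pos fun M N _ _ => by
        simpa using hKP (fun q : Fin M × Fin N => hlaw M N q.1 q.2) (hind M N)] with ω ⟨R, hR⟩
  refine ⟨R, fun M N hM hN hMN => ?_⟩
  have h := hR M N hM hN hMN
  simp only [not_le, Fintype.card_prod, Fintype.card_fin, Nat.cast_mul] at h
  have hpos : (0 : ℝ) < (M : ℝ) * N := by positivity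
  rw [termA, avg_eq_sum_prod, one_div, inv_mul_le_iff₀ hpos, mul_comm]
  exact h.le

/-- Weighted averages of the noise with bounded weights tend to zero almost surely. -/
lemma ae_abs_avg_mul_le (hlaw : ∀ M N i j, HasLaw (ε M N i j) (gaussianReal 0 v) P)
    (hind : ∀ M N, iIndepFun (fun q : Fin M × Fin N => ε M N q.1 q.2) P)
    {g : (M N : ℕ) → Fin M → Fin N → ℝ} {G : ℝ} (hg : ∀ M N i j, |g M N i j| ≤ G)
    {δ : ℝ} (hδ : 0 < δ) :
    ∀ᵐ ω ∂P, ∃ R : ℕ, ∀ M N : ℕ, 0 < M → 0 < N → R ≤ M * N →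
      |avg fun i j => ε M N i j ω * g M N i j| ≤ δ := by
  -- The `+ 1` keeps the proxy positive when the noise or the weights vanish, so that the decay rate
  -- is positive.
  set c : NNReal := Real.toNNReal (G ^ 2) * v + 1 with hc
  have hcpos : (0 : ℝ) < c := by rw [hc]; positivity
  have hgc : ∀ M N i j, g M N i j ^ 2 * v ≤ c := fun M N i j => by
    have h1 : g M N i j ^ 2 ≤ G ^ 2 := sq_le_sq' (abs_le.1 (hg M N i j)).1 (abs_le.1 (hg M N i j)).2
    have h2 := mul_le_mul_of_nonneg_right h1 v.coe_nonneg
    rw [hc]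
    push_cast
    rw [Real.coe_toNNReal _ (sq_nonneg G)]
    linarith
  filter_upwards [ae_exists_forall_notMem_of_measureReal_le_exp P
    (fun M N => {ω | δ * Fintype.card (Fin M × Fin N) ≤
      |∑ q : Fin M × Fin N, g M N q.1 q.2 * ε M N q.1 q.2 ω|}) (C := 2) (c := δ ^ 2 / (2 * c))
      (by positivity) fun M N _ _ => by
        simpa using measureReal_le_abs_sum_mul_gaussian_le (fun q : Fin M × Fin N => hlaw M N q.1 q.2) (hind M N)
          (a := fun q => g M N q.1 q.2) (fun q => hgc M N q.1 q.2) hδ.le] with ω ⟨R, hR⟩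
  refine ⟨R, fun M N hM hN hMN => ?_⟩
  have h := hR M N hM hN hMN
  simp only [not_le, Fintype.card_prod, Fintype.card_fin, Nat.cast_mul] at h
  have hpos : (0 : ℝ) < (M : ℝ) * N := by positivity
  rw [avg_eq_sum_prod, abs_mul, abs_of_pos (one_div_pos.2 hpos), one_div, inv_mul_le_iff₀ hpos,
    mul_comm _ δ]
  simpa only [mul_comm] using h.le

/-- Uniform law of large numbers: the interaction of the noise with the model misfit tends to zero
almost surely, uniformly on a compact set of parameters. -/
lemma ae_forall_abs_termD_le (hlaw : ∀ M N i j, HasLaw (ε M N i j) (gaussianReal 0 v) P)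
    (hind : ∀ M N, iIndepFun (fun q : Fin M × Fin N => ε M N q.1 q.2) P)
    {k : ℕ} {K : Set (Param k)} (hK : IsCompact K) {θ₀ : Param k} (hθ₀ : θ₀ ∈ K)
    {u₀ : ℝ → ℝ → Param k → ℝ} {L : ℝ} (hL : 0 ≤ L)
    (hlip : ∀ t ∈ timeDom, ∀ x ∈ spaceDom, ∀ θ ∈ K, ∀ θ' ∈ K,
      |u₀ t x θ - u₀ t x θ'| ≤ L * ‖θ - θ'‖) {δ : ℝ} (hδ : 0 < δ) :
    ∀ᵐ ω ∂P, ∃ R : ℕ, ∀ M N : ℕ, 0 < M → 0 < N → R ≤ M * N → ∀ θ ∈ K,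
      |termD u₀ θ₀ (fun i j => ε M N i j ω) θ| ≤ δ := by
  obtain ⟨A, hA, hAP⟩ := exists_ae_termA_le hlaw hind
  -- Moving to the nearest net point costs at most A·L·r ≤ δ/4, and the net point itself δ/4; the
  -- factor 2 in D gives δ. The `+ 1` covers A·L = 0.
  set r : ℝ := δ / (4 * (A * L + 1)) with hr
  have hrpos : 0 < r := by positivity
  obtain ⟨s, hsK, hsfin, hcov⟩ := finite_cover_balls_of_compact hK hrpos
  have hnet : ∀ᵐ ω ∂P, ∀ θ ∈ s, ∃ R : ℕ, ∀ M N : ℕ, 0 < M → 0 < N → R ≤ M * N →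
      |avg fun i j => ε M N i j ω *
        (u₀ (timePt M i) (spacePt N j) θ₀ - u₀ (timePt M i) (spacePt N j) θ)| ≤ δ / 4 :=
    (ae_ball_iff hsfin.countable).2 fun θ hθ => ae_abs_avg_mul_le hlaw hind
      (g := fun M N i j => u₀ (timePt M i) (spacePt N j) θ₀ - u₀ (timePt M i) (spacePt N j) θ)
      (fun M N i j => hlip _ (timePt_mem i) _ (spacePt_mem j) θ₀ hθ₀ θ (hsK hθ)) (by positivity)
  filter_upwards [hAP, hnet] with ω ⟨R₁, hR₁⟩ hω
  choose! R hR using hω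
  obtain ⟨R₂, hR₂⟩ := (hsfin.image R).bddAbove
  refine ⟨max R₁ R₂, fun M N hM hN hMN θ hθ => ?_⟩
  obtain ⟨θ', hθ', hdist⟩ := mem_iUnion₂.1 (hcov hθ)
  rw [Metric.mem_ball, dist_comm, dist_eq_norm] at hdist
  have h1 := hR θ' hθ' M N hM hN ((hR₂ ⟨θ', hθ', rfl⟩).trans ((le_max_right _ _).trans hMN))
  have h2 : |avg fun i j => ε M N i j ω *
      (u₀ (timePt M i) (spacePt N j) θ' - u₀ (timePt M i) (spacePt N j) θ)| ≤ A * (L * r) :=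
    abs_avg_mul_le hA (by positivity) (hR₁ M N hM hN ((le_max_left _ _).trans hMN))
      (avg_sq_le fun i j => (hlip _ (timePt_mem i) _ (spacePt_mem j) θ' (hsK hθ') θ hθ).trans
        (by gcongr))
  have h3 : A * (L * r) ≤ δ / 4 := by
    rw [hr, ← mul_assoc, mul_div_assoc', div_le_div_iff₀ (by positivity) (by positivity)]
    nlinarith
  have h4 : termD u₀ θ₀ (fun i j => ε M N i j ω) θ =
      2 * ((avg fun i j => ε M N i j ω *
        (u₀ (timePt M i) (spacePt N j) θ₀ - u₀ (timePt M i) (spacePt N j) θ')) +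
      avg fun i j => ε M N i j ω *
        (u₀ (timePt M i) (spacePt N j) θ' - u₀ (timePt M i) (spacePt N j) θ)) := by
    rw [termD, ← avg_add]
    congr 2
    funext i j
    ring
  rw [h4, abs_mul, abs_two]
  have := abs_add_le (avg fun i j => ε M N i j ω *
        (u₀ (timePt M i) (spacePt N j) θ₀ - u₀ (timePt M i) (spacePt N j) θ'))
      (avg fun i j => ε M N i j ω *
        (u₀ (timePt M i) (spacePt N j) θ' - u₀ (timePt M i) (spacePt N j) θ))
  linarith

end Noise


/-! ### Comparison of the costs at the estimate and at the true parameter. -/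

section Deterministic

variable {k M N : ℕ} {u₀ : ℝ → ℝ → Param k → ℝ} {u : ℝ → ℝ → ℝ → Param k → ℝ}
  {θ₀ θ : Param k} {e : Fin M → Fin N → ℝ} {h A W G H : ℝ}

lemma termA_nonneg : 0 ≤ termA e := avg_nonneg fun _ _ => sq_nonneg _

lemma termB_nonneg : 0 ≤ termB u₀ θ₀ θ M N := avg_nonneg fun _ _ => sq_nonneg _

lemma termC_nonneg : 0 ≤ termC u₀ u h θ M N := avg_nonneg fun _ _ => sq_nonneg _

lemma termC_le (herr : ∀ t ∈ timeDom, ∀ x ∈ spaceDom, |u₀ t x θ - u t x h θ| ≤ H) :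
    termC u₀ u h θ M N ≤ H ^ 2 :=
  avg_sq_le fun i j => herr _ (timePt_mem i) _ (spacePt_mem j)

lemma abs_termE_le (hA : 0 ≤ A) (hAe : termA e ≤ A ^ 2) (hH : 0 ≤ H)
    (herr : ∀ t ∈ timeDom, ∀ x ∈ spaceDom, |u₀ t x θ - u t x h θ| ≤ H) :
    |termE u₀ u e h θ| ≤ 2 * (A * H) := by
  rw [termE, abs_mul, abs_two]
  gcongr
  exact abs_avg_mul_le hA hH hAe (termC_le herr)

lemma abs_termF_le (hH : 0 ≤ H)
    (herr : ∀ t ∈ timeDom, ∀ x ∈ spaceDom, |u₀ t x θ - u t x h θ| ≤ H)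
    (hG : 0 ≤ G) (hB : termB u₀ θ₀ θ M N ≤ G ^ 2) :
    |termF u₀ u θ₀ h θ M N| ≤ 2 * (H * G) := by
  rw [termF, abs_mul, abs_two]
  gcongr
  exact abs_avg_mul_le hH hG (termC_le herr) hB

/-- The model misfit at an estimate, by comparing its cost with the cost of the true parameter. -/
lemma IsEstimate.termB_le {Θad : Set (Param k)} (hθ : IsEstimate u h θ Θad (data u₀ θ₀ e))
    (hθ₀ : θ₀ ∈ Θad) :
    termB u₀ θ₀ θ M N ≤ termC u₀ u h θ₀ M N + |termE u₀ u e h θ₀| + |termD u₀ θ₀ e θ| +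
      |termE u₀ u e h θ| + |termF u₀ u θ₀ h θ M N| := by
  have hmin := hθ.2 θ₀ hθ₀
  rw [cost_data_eq, cost_data_eq] at hmin
  have hB₀ : termB u₀ θ₀ θ₀ M N = 0 := by simp [termB, avg]
  have hD₀ : termD u₀ θ₀ e θ₀ = 0 := by simp [termD, avg]
  have hF₀ : termF u₀ u θ₀ h θ₀ M N = 0 := by simp [termF, avg]
  rw [hB₀, hD₀, hF₀] at hmin
  linarith [le_abs_self (termE u₀ u e h θ₀), neg_abs_le (termD u₀ θ₀ e θ),
    neg_abs_le (termE u₀ u e h θ), neg_abs_le (termF u₀ u θ₀ h θ M N),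
    termC_nonneg (u₀ := u₀) (u := u) (h := h) (θ := θ) (M := M) (N := N)]

/-- The model misfit at an estimate is of the order of the numerical error. -/
lemma IsEstimate.termB_le_mul {Θad : Set (Param k)} (hθ : IsEstimate u h θ Θad (data u₀ θ₀ e))
    (hθ₀ : θ₀ ∈ Θad) (hA : 0 ≤ A) (hAe : termA e ≤ A ^ 2) (hW : 0 ≤ W) (hG : 0 ≤ G)
    (hH : 0 ≤ H) (hH1 : H ≤ 1)
    (herr : ∀ t ∈ timeDom, ∀ x ∈ spaceDom, ∀ θ ∈ Θad, |u₀ t x θ - u t x h θ| ≤ W * H)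
    (hB : termB u₀ θ₀ θ M N ≤ G ^ 2) (hD : |termD u₀ θ₀ e θ| ≤ H) :
    termB u₀ θ₀ θ M N ≤ (W ^ 2 + 4 * (A * W) + 1 + 2 * (W * G)) * H := by
  have hWH : 0 ≤ W * H := mul_nonneg hW hH
  have h1 := hθ.termB_le hθ₀
  have h2 : termC u₀ u h θ₀ M N ≤ (W * H) ^ 2 := termC_le fun t ht x hx => herr t ht x hx θ₀ hθ₀
  have h3 := abs_termE_le hA hAe hWH fun t ht x hx => herr t ht x hx θ₀ hθ₀
  have h4 := abs_termE_le hA hAe hWH fun t ht x hx => herr t ht x hx θ hθ.1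
  -- The a priori bound `G` on the misfit suffices here, as F only has to be linear in `H`.
  have h5 := abs_termF_le hWH (fun t ht x hx => herr t ht x hx θ hθ.1) hG hB
  have h6 : (W * H) ^ 2 ≤ W ^ 2 * H := by
    rw [mul_pow]
    gcongr
    exact pow_le_of_le_one hH hH1 two_ne_zero
  linarith

end Deterministic

end NumOLS

/-! ### Assembling the bounds. -/

theorem lemma1 {k : ℕ} {Ω : Type*} [MeasurableSpace Ω] (P : Measure Ω) [IsProbabilityMeasure P]
    -- parameter domain, compact admissible set, true parameter
    (Θ Θad : Set (NumOLS.Param k)) (hΘ : IsOpen Θ) (hΘc : Convex ℝ Θ)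
    (hΘad : IsCompact Θad) (hsub : Θad ⊆ Θ) (θ₀ : NumOLS.Param k) (hθ₀ : θ₀ ∈ Θad)
    -- exact model, numerical solution, numerical sensitivities, all of order `p`
    (u₀ : ℝ → ℝ → NumOLS.Param k → ℝ) (hu₀ : NumOLS.SmoothInParam Θ u₀)
    (p : ℝ) (hp : 0 < p)
    (u : ℝ → ℝ → ℝ → NumOLS.Param k → ℝ) (hu : NumOLS.HasOrder Θ p u₀ u)
    (s : ℝ → ℝ → ℝ → NumOLS.Param k → NumOLS.Param k)
    (hs : NumOLS.HasOrder Θ p (fun t x θ => gradient (u₀ t x) θ) s)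
    -- for each `M`, `N` a data set of that size, with i.i.d. centred Gaussian noise
    (η : NNReal) (ε : (M N : ℕ) → Fin M → Fin N → Ω → ℝ)
    (hlaw : ∀ M N i j, HasLaw (ε M N i j) (gaussianReal 0 (η ^ 2)) P)
    (hind : ∀ M N, iIndepFun (fun q : Fin M × Fin N => ε M N q.1 q.2) P) :
    -- the cost splits into the six terms
    (∀ (M N : ℕ) (ω : Ω) (h : ℝ) (θ : NumOLS.Param k),
      NumOLS.cost u h θ (NumOLS.data u₀ θ₀ fun i j => ε M N i j ω) =
        NumOLS.termA (fun i j => ε M N i j ω) + NumOLS.termB u₀ θ₀ θ M N +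
        NumOLS.termC u₀ u h θ M N + NumOLS.termD u₀ θ₀ (fun i j => ε M N i j ω) θ +
        NumOLS.termE u₀ u (fun i j => ε M N i j ω) h θ + NumOLS.termF u₀ u θ₀ h θ M N) ∧
    ∃ K > (0 : ℝ), ∃ h₀ > (0 : ℝ),
      -- for each fixed data set
      (∀ (ω : Ω) (M N : ℕ), 0 < M → 0 < N → ∃ L : ℝ, ∀ h ∈ Ioo 0 h₀, ∀ θ : NumOLS.Param k,
        NumOLS.IsEstimate u h θ Θad (NumOLS.data u₀ θ₀ fun i j => ε M N i j ω) →
          |NumOLS.termA (fun i j => ε M N i j ω)| ≤ L ∧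
          |NumOLS.termC u₀ u h θ M N| ≤ K * h ^ (2 * p) ∧
          |NumOLS.termE u₀ u (fun i j => ε M N i j ω) h θ| ≤ L * h ^ p) ∧
      -- almost surely, for each step size, once there are enough data points
      (∀ᵐ ω ∂P, ∀ h ∈ Ioo 0 h₀, ∃ R : ℕ, ∀ M N : ℕ, 0 < M → 0 < N → R ≤ M * N →
        ∀ θ : NumOLS.Param k,
        NumOLS.IsEstimate u h θ Θad (NumOLS.data u₀ θ₀ fun i j => ε M N i j ω) →
          |NumOLS.termA (fun i j => ε M N i j ω)| ≤ K ∧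
          |NumOLS.termB u₀ θ₀ θ M N| ≤ K * h ^ p ∧
          |NumOLS.termC u₀ u h θ M N| ≤ K * h ^ (2 * p) ∧
          |NumOLS.termD u₀ θ₀ (fun i j => ε M N i j ω) θ| ≤ K * h ^ (p / 2) ∧
          |NumOLS.termE u₀ u (fun i j => ε M N i j ω) h θ| ≤ K * h ^ p ∧
          |NumOLS.termF u₀ u θ₀ h θ M N| ≤ K * h ^ (3 * p / 2)) := by
  refine ⟨fun M N ω h θ => NumOLS.cost_data_eq u₀ u θ₀ _ h θ, ?_⟩
  obtain ⟨L, hL, hlip⟩ := hu₀.exists_lipschitz hΘc hΘad hsub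
  obtain ⟨W, hW, h₁, hh₁, herr⟩ := hu.exists_error_le hΘad hsub
  obtain ⟨A, hA, hAP⟩ := NumOLS.exists_ae_termA_le hlaw hind
  obtain ⟨ρ, hρ⟩ := hΘad.isBounded.exists_norm_le
  have hρ0 : 0 ≤ ρ := (norm_nonneg _).trans (hρ θ₀ hθ₀)
  -- Lipschitz constant times a bound on the diameter of `Θad`.
  set G : ℝ := L * (ρ + ρ) with hG
  have hG0 : 0 ≤ G := by positivity
  have hmis : ∀ (M N : ℕ), ∀ θ ∈ Θad, NumOLS.termB u₀ θ₀ θ M N ≤ G ^ 2 := fun M N θ hθ =>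
    NumOLS.avg_sq_le fun i j => (hlip _ (NumOLS.timePt_mem i) _ (NumOLS.spacePt_mem j)
      θ₀ hθ₀ θ hθ).trans (mul_le_mul_of_nonneg_left
        ((norm_sub_le _ _).trans (add_le_add (hρ θ₀ hθ₀) (hρ θ hθ))) hL)
  set KB : ℝ := W ^ 2 + 4 * (A * W) + 1 + 2 * (W * G) with hKB
  have hKB0 : 0 ≤ KB := by positivity
  have hKF : 0 ≤ W * √KB := by positivity
  have hAW : 0 ≤ A * W := by positivity
  have hWG : 0 ≤ W * G := by positivity
  have hA2 := sq_nonneg A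
  have hW2 := sq_nonneg W
  -- The summands serve A, B and F; `KB` also dominates W², 2AW and 1, as needed for C, E and D. The
  -- cap `1` on the step size makes higher powers of h smaller.
  refine ⟨A ^ 2 + KB + 2 * (W * √KB), by positivity, min h₁ 1, by positivity, ?_, ?_⟩
  · intro ω M N hM hN
    refine ⟨|NumOLS.termA fun i j => ε M N i j ω| +
      2 * (√(NumOLS.termA fun i j => ε M N i j ω) * W), fun h hh θ hθ => ⟨?_, ?_, ?_⟩⟩
    · exact le_add_of_nonneg_right (by positivity)
    · have hC := NumOLS.termC_le (M := M) (N := N) fun t ht x hx =>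
        herr h ⟨hh.1, hh.2.trans_le (min_le_left _ _)⟩ t ht x hx θ hθ.1
      rw [abs_of_nonneg NumOLS.termC_nonneg, two_mul p, Real.rpow_add hh.1, ← sq]
      rw [mul_pow] at hC
      exact hC.trans (mul_le_mul_of_nonneg_right (by linarith) (sq_nonneg _))
    · have hH : 0 ≤ h ^ p := Real.rpow_nonneg hh.1.le p
      have hE := NumOLS.abs_termE_le (e := fun i j => ε M N i j ω) (Real.sqrt_nonneg _)
        (Real.sq_sqrt NumOLS.termA_nonneg).ge (mul_nonneg hW hH) fun t ht x hx =>
        herr h ⟨hh.1, hh.2.trans_le (min_le_left _ _)⟩ t ht x hx θ hθ.1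
      refine hE.trans ?_
      rw [← mul_assoc, ← mul_assoc, ← mul_assoc]
      exact mul_le_mul_of_nonneg_right (le_add_of_nonneg_left (abs_nonneg _)) hH
  -- The exceptional null set must not depend on h, so D is controlled at countably many thresholds,
  -- one of which lies below h^p.
  · have hD : ∀ᵐ ω ∂P, ∀ n : ℕ, ∃ R : ℕ, ∀ M N : ℕ, 0 < M → 0 < N → R ≤ M * N → ∀ θ ∈ Θad,
        |NumOLS.termD u₀ θ₀ (fun i j => ε M N i j ω) θ| ≤ 1 / ((n : ℝ) + 1) :=
      ae_all_iff.2 fun n =>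
        NumOLS.ae_forall_abs_termD_le hlaw hind hΘad hθ₀ hL hlip Nat.one_div_pos_of_nat
    filter_upwards [hAP, hD] with ω ⟨R₁, hR₁⟩ hω h hh
    set H : ℝ := h ^ p with hHdef
    set S : ℝ := h ^ (p / 2) with hSdef
    have hH : 0 < H := Real.rpow_pos_of_pos hh.1 p
    have hS : 0 < S := Real.rpow_pos_of_pos hh.1 _
    have hh1 : h ≤ 1 := (hh.2.trans_le (min_le_right _ _)).le
    have hH1 : H ≤ 1 := Real.rpow_le_one hh.1.le hh1 hp.le
    have hS1 : S ≤ 1 := Real.rpow_le_one hh.1.le hh1 (by positivity)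
    have hSS : S ^ 2 = H := by
      rw [hSdef, sq, ← Real.rpow_add hh.1, add_halves]
    have hHS : H ≤ S := by
      rw [← hSS]
      exact pow_le_of_le_one hS.le hS1 two_ne_zero
    have hHH : h ^ (2 * p) = H ^ 2 := by rw [two_mul, Real.rpow_add hh.1, sq]
    have hHSp : h ^ (3 * p / 2) = H * S := by
      rw [hHdef, hSdef, ← Real.rpow_add hh.1]
      congr 1
      ring
    obtain ⟨n, hn⟩ := exists_nat_one_div_lt hH
    obtain ⟨R₂, hR₂⟩ := hω n
    refine ⟨max R₁ R₂, fun M N hM hN hMN θ hθ => ?_⟩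
    have hAe := hR₁ M N hM hN ((le_max_left _ _).trans hMN)
    have hDe := (hR₂ M N hM hN ((le_max_right _ _).trans hMN) θ hθ.1).trans hn.le
    have herr' := herr h ⟨hh.1, hh.2.trans_le (min_le_left _ _)⟩
    have herrθ := fun t ht x hx => herr' t ht x hx θ hθ.1
    have hB := hθ.termB_le_mul hθ₀ hA hAe hW hG0 hH.le hH1 herr' (hmis M N θ hθ.1) hDe
    rw [← hKB] at hB
    rw [hHH, hHSp]
    refine ⟨?_, ?_, ?_, ?_, ?_, ?_⟩
    · rw [abs_of_nonneg NumOLS.termA_nonneg]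
      linarith
    · rw [abs_of_nonneg NumOLS.termB_nonneg]
      exact hB.trans (mul_le_mul_of_nonneg_right (by linarith) hH.le)
    · rw [abs_of_nonneg NumOLS.termC_nonneg]
      refine (NumOLS.termC_le herrθ).trans ?_
      rw [mul_pow]
      exact mul_le_mul_of_nonneg_right (by linarith) (sq_nonneg _)
    · exact (hDe.trans hHS).trans (le_mul_of_one_le_left hS.le (by linarith))
    · refine (NumOLS.abs_termE_le hA hAe (by positivity) herrθ).trans ?_
      rw [← mul_assoc, ← mul_assoc, mul_assoc 2]
      exact mul_le_mul_of_nonneg_right (by linarith) hH.le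
    -- Second pass: the bound on B just obtained replaces `G`, gaining the factor h^(p/2).
    · have hB' : NumOLS.termB u₀ θ₀ θ M N ≤ (√KB * S) ^ 2 := by
        rwa [mul_pow, Real.sq_sqrt hKB0, hSS]
      refine (NumOLS.abs_termF_le (by positivity) herrθ (by positivity) hB').trans ?_
      calc 2 * (W * H * (√KB * S)) = 2 * (W * √KB) * (H * S) := by ring
        _ ≤ _ := mul_le_mul_of_nonneg_right (by linarith) (by positivity)
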